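/- Let $\mathfrak C$ be a large saturated (monster) model of a complete first-order, possibly many-sorted, theory, let $A\subset\mathfrak C$ be small ($|A|<|\mathfrak C|$), and let $p\in S_n(A)$ be a complete type in finitely many variables with locus $p(\mathfrak C)$. Let $<$ be a linear order on $p(\mathfrak C)$ such that $(p,<)$ is a weakly o-minimal pair over $A$; that is, $<$ is relatively $A$-definable (the trace on $p(\mathfrak C)^2$ of an $A$-definable relation), and every relatively definable subset of $p(\mathfrak C)$ (the trace on $p(\mathfrak C)$ of a set definable with parameters from $\mathfrak C$) has finitely many convex components with respect to $<$. Let $\mathbf p_r$ be the right globalization of $(p,<)$: the set of all formulas $\phi(x)$ with parameters from $\mathfrak C$ such that $\phi(\mathfrak C)\cap p(\mathfrak C)$ contains a non-empty final part of $(p(\mathfrak C),<)$. For a linear order $J$, a sequence $(a_j\mid j\in J)$ is a Morley sequence in $\mathbf p_r$ over $A$ if, for every $j\in J$, $a_j$ realizes the restriction of $\mathbf p_r$ to $A\cup\{a_i\mid i<j\}$. Suppose that $I=(a_j\mid j\in J)$ is a (possibly finite) Morley sequence in $\mathbf p_r$ over $A$, consisting of realizations of $p$. Then: (i) If $a\in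 p(\mathfrak C)$ lies in the $<$-convex hull of $\{a_j\mid j\in J\}$, then one can remove at most one element from $I$ and insert $a$ at some place in the sequence so that the resulting sequence is again a Morley sequence in $\mathbf p_r$ over $A$. (ii) If $I'=(a'_j\mid j\in J)$ is a sequence of realizations of $p$ such that, for every $j\in J$, $a'_j$ is forking-dependent on $a_j$ over $A$ (that is, $\mathrm{tp}(a'_j/A a_j)$ forks over $A$), then $I'$ is a Morley sequence in $\mathbf p_r$ over $A$. -/

import Mathlib

open FirstOrder FirstOrder.Language

/-! Model-theoretic notions inside one (saturated) structure `M`.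

Formulas with parameters are handled through the sets they define: `B.Definable L D` says that
`D` is the solution set in `M` of a formula with parameters from `B`. -/

section Saturation

variable (L : FirstOrder.Language) (M : Type*) [L.Structure M]

/-- `M` is a saturated model (of its complete theory `Th(M)`), possibly many-sorted: every set of
formulas over a small set `A` (i.e. `|A| < |M|`) in finitely many sorted variables that is finitely
satisfiable in `M` is satisfied in `M`.

A many-sorted structure is presented on the disjoint union `M` of its sorts; `sort x` is the sort of
the element `x`, and every sort is `∅`-definable. A sequence of variables `x` of sorts `σ` ranges
over the tuples with `sort ∘ x = σ`. The one-sorted case is `S = Unit`, where the conditions on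
sorts are empty. -/
structure IsSaturatedModel {S : Type*} (sort : M → S) : Prop where
  definable_sort : ∀ s : S, (∅ : Set M).Definable₁ L {x | sort x = s}
  realizes : ∀ A : Set M, Cardinal.mk A < Cardinal.mk M →
    ∀ (k : ℕ) (σ : Fin k → S) (F : Set (Set (Fin k → M))),
      (∀ D ∈ F, A.Definable L D) →
      (∀ G ⊆ F, G.Finite → ∃ x : Fin k → M, sort ∘ x = σ ∧ ∀ D ∈ G, x ∈ D) →
      ∃ x : Fin k → M, sort ∘ x = σ ∧ ∀ D ∈ F, x ∈ D

end Saturation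

section LinearOrders

variable {X : Type*} [LinearOrder X]

/-- `C` is a convex component of `D`: a maximal convex subset of `D`. -/
def IsConvexComponent (D C : Set X) : Prop :=
  Maximal (fun C' : Set X => C'.OrdConnected ∧ C' ⊆ D) C

/-- `D` contains a non-empty final part of `X`. -/
def RightEventual (D : Set X) : Prop :=
  ∃ U : Set X, U.Nonempty ∧ IsUpperSet U ∧ U ⊆ D

/-- The convex hull of `Y` in the linear order `X`: the least convex set containing `Y`. -/
def orderConvexHull (Y : Set X) : Set X :=
  ⋂₀ {C : Set X | C.OrdConnected ∧ Y ⊆ C}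

end LinearOrders

section Types

variable {L : FirstOrder.Language} {M : Type*} [L.Structure M]

/-- The space `S_n(A)` of complete `n`-types over `A`. -/
abbrev TypesOver (L : FirstOrder.Language) {M : Type*} [L.Structure M] (A : Set M) (n : ℕ) :
    Type _ :=
  Theory.CompleteType (L[[A]].completeTheory M) (Fin n)

/-- The locus `p(M)`: the set of realizations of the complete type `p` in `M`. -/
def locus {A : Set M} {n : ℕ} (p : TypesOver L A n) : Set (Fin n → M) :=
  {a | ∀ φ : L[[A]].Formula (Fin n), Formula.equivSentence φ ∈ p → φ.Realize a}

/-- `b ≡ c (A)`: the tuples `b` and `c` have the same type over `A`. -/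
def SameType (L : FirstOrder.Language) {M : Type*} [L.Structure M] (A : Set M) {m : ℕ}
    (b c : Fin m → M) : Prop :=
  ∀ D : Set (Fin m → M), A.Definable L D → (b ∈ D ↔ c ∈ D)

/-- The formula `φ(x, b)` divides over `A`: for some `k` there is a sequence `(bᵢ)` of realizations
of `tp(b/A)` such that the family `φ(x, bᵢ)` is `k`-inconsistent. -/
def FormulaDivides (A : Set M) {n m : ℕ} (φ : L.Formula (Fin n ⊕ Fin m)) (b : Fin m → M) : Prop :=
  ∃ (k : ℕ) (s : ℕ → Fin m → M), (∀ i, SameType L A (s i) b) ∧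
    ∀ F : Finset ℕ, F.card = k → ¬ ∃ x : Fin n → M, ∀ i ∈ F, φ.Realize (Sum.elim x (s i))

/-- The formula defining `D` forks over `A`: it implies a finite disjunction of formulas, each of
which divides over `A`. -/
def FormulaForks (L : FirstOrder.Language) {M : Type*} [L.Structure M] (A : Set M) {n : ℕ}
    (D : Set (Fin n → M)) : Prop :=
  ∃ F : Set (Set (Fin n → M)), F.Finite ∧
    (∀ E ∈ F, ∃ (m : ℕ) (φ : L.Formula (Fin n ⊕ Fin m)) (b : Fin m → M),
      FormulaDivides A φ b ∧ E = {x | φ.Realize (Sum.elim x b)}) ∧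
    D ⊆ ⋃₀ F

/-- `a` is forking-independent of `B` over `A`: no formula of `tp(a/AB)` forks over `A`. -/
def ForkIndep (L : FirstOrder.Language) {M : Type*} [L.Structure M] (A : Set M) {n : ℕ}
    (a : Fin n → M) (B : Set M) : Prop :=
  ¬ ∃ D : Set (Fin n → M), (A ∪ B).Definable L D ∧ a ∈ D ∧ FormulaForks L A D

/-- `a` realizes the restriction to `B` of the global type `P`. A global type is given as the
collection of the sets defined by its formulas. -/
def RealizesRestriction (L : FirstOrder.Language) {M : Type*} [L.Structure M] {n : ℕ}
    (P : Set (Set (Fin n → M))) (B : Set M) (a : Fin n → M) : Prop :=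
  ∀ D ∈ P, B.Definable L D → a ∈ D

/-- `(a j | j ∈ J)` is a Morley sequence in the global type `P` over `A`: each `a j` realizes the
restriction of `P` to `A` together with all earlier terms. -/
def IsMorleySeq (L : FirstOrder.Language) {M : Type*} [L.Structure M] {n : ℕ}
    (P : Set (Set (Fin n → M))) (A : Set M) {J : Type*} [LinearOrder J] (a : J → Fin n → M) :
    Prop :=
  ∀ j : J, RealizesRestriction L P (A ∪ ⋃ i ∈ Set.Iio j, Set.range (a i)) (a j)

variable {A : Set M} {n : ℕ} (p : TypesOver L A n) [LinearOrder (locus p)]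

/-- `(p, <)` is a weakly o-minimal pair over `A`: the linear order `<` on `p(M)` is relatively
`A`-definable, and every relatively definable subset of `p(M)` has finitely many convex
components. -/
structure IsWeaklyOMinimalPair : Prop where
  relDefinable_lt : ∃ E : Set (Fin n ⊕ Fin n → M), A.Definable L E ∧
    ∀ x y : locus p, x < y ↔ Sum.elim x.1 y.1 ∈ E
  finite_components : ∀ D : Set (Fin n → M), (Set.univ : Set M).Definable L D →
    {C : Set (locus p) | IsConvexComponent (Subtype.val ⁻¹' D) C}.Finite

/-- The right globalization of `(p, <)`: all formulas over `M` whose solution set is right-eventual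
in `p(M)`. -/
def rightGlobalization : Set (Set (Fin n → M)) :=
  {D | (Set.univ : Set M).Definable L D ∧
    RightEventual (Subtype.val ⁻¹' D : Set (locus p))}

end Types

/-- The sequence obtained from `(a j | j ∈ J)` by removing the terms with index in `R` and inserting
`c` between the (remaining) terms with index in the initial part `U` of `J` and the other ones. -/
def removeInsert {J X : Type*} [LinearOrder J] (a : J → X) (R : Set J) (U : LowerSet J) (c : X) :
    {j : J // j ∈ U ∧ j ∉ R} ⊕ₗ (Unit ⊕ₗ {j : J // j ∉ U ∧ j ∉ R}) → X :=
  fun t => Sum.elim (fun j => a j.1)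
    (fun t' => Sum.elim (fun _ => c) (fun j => a j.1) (ofLex t')) (ofLex t)

/-! Weak o-minimality enters through convexity: over a set differing from `A` by finitely many
elements, the realizations in the locus of any one type form a convex set (`eqType_of_between`),
since homogeneity would turn a single alternation into infinitely many. The right globalization is
moreover complete and `A`-invariant, so the elements fitting a given place of a finite Morley
sequence realize one type over the other terms. They therefore form a convex set
(`morleyList_of_between`), which is nonempty (`exists_morleyList_insert`).

For (ii), a set containing a final part of the locus does not fork over `A`, because finitely many
of its conjugates always meet; by reversing the order, neither does one containing an initial part.
Insert `u` just before and `v` just after a term `x`. All elements below `u` have one type over `A`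
and `x`, and so do all elements above `v`; hence an element `y` forking-dependent on `x` satisfies
`u ≤ y ≤ v`. Once `x` is dropped, `u` and `v` both fit its place, and so does `y`. Terms of a finite
subsequence are replaced one at a time.

For (i), a new element `c` cuts the sequence in two. If there is no last term below `c` or no first
term above it, dropping the one that exists (if any) leaves terms on both sides of `c` that fit the
place of `c` in any given finite subsequence. If both exist, insert some `y` between them: `c` lies
between `y` and one of the two, and can replace that one. The choice has to serve all finite
subsequences at once, so failures of both choices are refuted inside one common finite sequence. -/

/-! ### Types of tuples over a parameter set. -/

section TypeEquality

variable {L : FirstOrder.Language} {M : Type*} [L.Structure M]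

/-- The families `v` and `w` have the same type over `B`. -/
def EqType (L : FirstOrder.Language) {M : Type*} [L.Structure M] (B : Set M) {ι : Type*}
    (v w : ι → M) : Prop :=
  ∀ D : Set (ι → M), B.Definable L D → (v ∈ D ↔ w ∈ D)

namespace EqType

variable {B C : Set M} {ι κ : Type*} {u v w : ι → M}

theorem refl (B : Set M) (v : ι → M) : EqType L B v v := fun _ _ => Iff.rfl

theorem symm (h : EqType L B v w) : EqType L B w v := fun D hD => (h D hD).symm

theorem trans (h : EqType L B u v) (h' : EqType L B v w) : EqType L B u w :=
  fun D hD => (h D hD).trans (h' D hD)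

theorem mono (h : EqType L C v w) (hBC : B ⊆ C) : EqType L B v w :=
  fun D hD => h D (hD.mono hBC)

theorem comp (h : EqType L B v w) (f : κ → ι) : EqType L B (v ∘ f) (w ∘ f) :=
  fun _ hD => h _ (hD.preimage_comp f)

theorem of_imp (h : ∀ D : Set (ι → M), B.Definable L D → v ∈ D → w ∈ D) : EqType L B v w :=
  fun D hD => ⟨h D hD, fun hw => by_contra fun hv => h Dᶜ hD.compl hv hw⟩

theorem swap {v v' : ι → M} {w w' : κ → M} (h : EqType L B (Sum.elim v w) (Sum.elim v' w')) :
    EqType L B (Sum.elim w v) (Sum.elim w' v') := by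
  simpa using h.comp Sum.swap

theorem left {v v' : ι → M} {w w' : κ → M} (h : EqType L B (Sum.elim v w) (Sum.elim v' w')) :
    EqType L B v v' := by
  simpa using h.comp Sum.inl

theorem right {v v' : ι → M} {w w' : κ → M} (h : EqType L B (Sum.elim v w) (Sum.elim v' w')) :
    EqType L B w w' := by
  simpa using h.comp Sum.inr

end EqType

/-- Parameters `b` can be replaced by variables. -/
theorem definable_union_range_iff {B : Set M} {α β : Type*} {b : β → M} {D : Set (α → M)} :
    (B ∪ Set.range b).Definable L D ↔
      ∃ E : Set (α ⊕ β → M), B.Definable L E ∧ D = {x | Sum.elim x b ∈ E} := by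
  classical
  constructor
  · rw [Set.definable_iff_exists_formula_sum]
    rintro ⟨φ, rfl⟩
    let g : ↥(B ∪ Set.range b) ⊕ α → B ⊕ (α ⊕ β) :=
      Sum.elim (fun c => if h : c.1 ∈ B then Sum.inl ⟨c.1, h⟩
        else Sum.inr (Sum.inr (c.2.resolve_left h).choose)) (fun a => Sum.inr (Sum.inl a))
    refine ⟨{v | (φ.relabel g).Realize (Sum.elim (↑) v)},
      Set.definable_iff_exists_formula_sum.2 ⟨_, rfl⟩, ?_⟩
    ext x
    simp only [Set.mem_ofPred_eq, Formula.realize_relabel]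
    have : (Sum.elim (fun c : B => (c : M)) (Sum.elim x b)) ∘ g
        = Sum.elim (fun c : ↥(B ∪ Set.range b) => (c : M)) x := by
      ext (c | a)
      · by_cases h : c.1 ∈ B
        · simp [g, h]
        · simpa [g, h] using (c.2.resolve_left h).choose_spec
      · simp [g]
    rw [this]
  · rintro ⟨E, hE, rfl⟩
    obtain ⟨φ, rfl⟩ := Set.definable_iff_exists_formula_sum.1 hE
    let g : B ⊕ (α ⊕ β) → ↥(B ∪ Set.range b) ⊕ α :=
      Sum.elim (fun c => Sum.inl ⟨c.1, Or.inl c.2⟩)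
        (Sum.elim Sum.inr (fun i => Sum.inl ⟨b i, Or.inr ⟨i, rfl⟩⟩))
    refine Set.definable_iff_exists_formula_sum.2 ⟨φ.relabel g, ?_⟩
    ext x
    simp only [Set.mem_ofPred_eq, Formula.realize_relabel]
    have : (Sum.elim (fun c : ↥(B ∪ Set.range b) => (c : M)) x) ∘ g
        = Sum.elim (fun c : B => (c : M)) (Sum.elim x b) := by
      ext (c | a | i) <;> simp [g]
    rw [this]

theorem eqType_union_range_iff {B : Set M} {ι κ : Type*} {v w : ι → M} {b : κ → M} :
    EqType L (B ∪ Set.range b) v w ↔ EqType L B (Sum.elim v b) (Sum.elim w b) := by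
  constructor
  · intro h E hE
    exact h {x | Sum.elim x b ∈ E} (definable_union_range_iff.2 ⟨E, hE, rfl⟩)
  · intro h D hD
    obtain ⟨E, hE, rfl⟩ := definable_union_range_iff.1 hD
    exact h E hE

end TypeEquality

theorem finite_union_range_sdiff {M ι : Type*} [Finite ι] {A B : Set M} (hB : (B \ A).Finite)
    (w : ι → M) : ((B ∪ Set.range w) \ A).Finite :=
  (hB.union (Set.finite_range w)).subset
    (by rw [Set.union_sdiff_distrib]; exact Set.union_subset_union_right _ Set.sdiff_subset)

/-! ### Convexity of types, the right globalization and forking. -/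

section OrderedLocus

variable {L : FirstOrder.Language} {M : Type*} [L.Structure M]

/-- The properties of an enumeration `val` of the locus of a weakly o-minimal pair over `A` in a
saturated model: all its values have the same type over `A`, the order is relatively `A`-definable,
relatively definable sets do not alternate infinitely often, and small types in the locus that are
directed and finitely satisfiable are realized. All properties are invariant under reversing the
order. -/
structure IsOrderedLocus (L : FirstOrder.Language) {M : Type*} [L.Structure M] (A : Set M) {n : ℕ}
    {X : Type*} [LinearOrder X] (val : X → Fin n → M) : Prop where
  same : ∀ x y, EqType L A (val x) (val y)
  lt_iff : ∃ E : Set (Fin n ⊕ Fin n → M), A.Definable L E ∧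
    ∀ x y : X, x < y ↔ Sum.elim (val x) (val y) ∈ E
  not_alternating : ∀ D : Set (Fin n → M), (Set.univ : Set M).Definable L D →
    ∀ t y : ℕ → X, (∀ i, val (t i) ∉ D ∧ val (y i) ∈ D) →
      ¬ ((∀ i, t i < y i ∧ y i < t (i + 1)) ∨ (∀ i, y i < t i ∧ t (i + 1) < y i))
  realize : X → ∀ B : Set M, A ⊆ B → (B \ A).Finite → ∀ F : Set (Set (Fin n → M)),
    F.Nonempty → (∀ D ∈ F, ∀ E ∈ F, D ∩ E ∈ F) → (∀ D ∈ F, B.Definable L D) →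
    (∀ D ∈ F, ∀ E : Set (Fin n → M), A.Definable L E → Set.range val ⊆ E → (D ∩ E).Nonempty) →
    ∃ x : X, ∀ D ∈ F, val x ∈ D

variable {A : Set M} {n : ℕ} {X : Type*} [LinearOrder X] {val : X → Fin n → M}

theorem rightEventual_iff {D : Set X} : RightEventual D ↔ ∃ u, ∀ y, u ≤ y → y ∈ D := by
  constructor
  · rintro ⟨U, ⟨u, hu⟩, hU, hD⟩
    exact ⟨u, fun y hy => hD (hU hy hu)⟩
  · rintro ⟨u, hu⟩
    exact ⟨Set.Ici u, ⟨u, le_rfl⟩, isUpperSet_Ici u, hu⟩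

/-- `x` realizes the restriction to `B` of the right globalization. -/
def RightGeneric (L : FirstOrder.Language) {M : Type*} [L.Structure M] {n : ℕ}
    {X : Type*} [LinearOrder X] (val : X → Fin n → M) (B : Set M) (x : X) : Prop :=
  ∀ D : Set (Fin n → M), B.Definable L D → RightEventual (val ⁻¹' D) → val x ∈ D

theorem RightGeneric.mono {B C : Set M} {x : X} (h : RightGeneric L val C x) (hBC : B ⊆ C) :
    RightGeneric L val B x :=
  fun D hD => h D (hD.mono hBC)

theorem RightGeneric.congr {B : Set M} {x y : X} (h : RightGeneric L val B x)
    (hxy : EqType L B (val x) (val y)) : RightGeneric L val B y :=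
  fun D hD hE => (hxy D hD).1 (h D hD hE)

namespace IsOrderedLocus

variable {B : Set M}

theorem dual (h : IsOrderedLocus L A val) :
    IsOrderedLocus L A (X := Xᵒᵈ) (fun x => val (OrderDual.ofDual x)) where
  same x y := h.same _ _
  lt_iff := by
    obtain ⟨E, hE, hlt⟩ := h.lt_iff
    refine ⟨_, hE.preimage_comp Sum.swap, fun x y => ?_⟩
    have := hlt (OrderDual.ofDual y) (OrderDual.ofDual x)
    simpa using this
  not_alternating D hD t y hty H :=
    h.not_alternating D hD (fun i => OrderDual.ofDual (t i)) (fun i => OrderDual.ofDual (y i)) hty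
      H.symm
  realize x B hAB hB F hF hI hD hE := h.realize x B hAB hB F hF hI hD hE

/-- Homogeneity: types over small sets extend along elements of the locus. -/
theorem extend (h : IsOrderedLocus L A val) (hAB : A ⊆ B) (hB : (B \ A).Finite) {ι : Type*}
    [Finite ι] {v w : ι → M} (hvw : EqType L B v w) (c : X) :
    ∃ c' : X, EqType L B (Sum.elim (val c) v) (Sum.elim (val c') w) := by
  have hfin := finite_union_range_sdiff hB w
  obtain ⟨x, hx⟩ := h.realize c (B ∪ Set.range w) (hAB.trans Set.subset_union_left) hfin
    {D | ∃ E : Set (Fin n ⊕ ι → M), B.Definable L E ∧ Sum.elim (val c) v ∈ E ∧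
      D = {x | Sum.elim x w ∈ E}}
    ⟨_, Set.univ, Set.definable_univ, trivial, rfl⟩
    (by
      rintro _ ⟨E, hE, hcE, rfl⟩ _ ⟨E', hE', hcE', rfl⟩
      exact ⟨E ∩ E', hE.inter hE', ⟨hcE, hcE'⟩, rfl⟩)
    (by
      rintro _ ⟨E, hE, hcE, rfl⟩
      exact definable_union_range_iff.2 ⟨E, hE, rfl⟩)
    -- The existential formula "some `u` in `E'` satisfies `E` together with the given tuple" is
    -- over `B` and holds of `v` with witness `val c`, so it holds of `w`.
    (by
      rintro _ ⟨E, hE, hcE, rfl⟩ E' hE' hsub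
      have h1 : B.Definable L {v : ι → M | ∃ u : Fin n → M,
          Sum.elim v u ∈ (fun g : ι ⊕ Fin n → M => g ∘ Sum.swap) ⁻¹'
            (E ∩ (fun g : Fin n ⊕ ι → M => g ∘ Sum.inl) ⁻¹' E')} :=
        Set.Definable.exists_of_finite
          ((hE.inter ((hE'.mono hAB).preimage_comp Sum.inl)).preimage_comp Sum.swap)
      obtain ⟨u, hu⟩ := (hvw _ h1).1 ⟨val c, by
        simpa using And.intro hcE (hsub ⟨c, rfl⟩)⟩
      exact ⟨u, by simpa using hu⟩)
  exact ⟨x, EqType.of_imp fun D hD hc => hx _ ⟨D, hD, hc, rfl⟩⟩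

theorem lt_congr (h : IsOrderedLocus L A val) (hAB : A ⊆ B) {x y x' y' : X}
    (hxy : EqType L B (Sum.elim (val x) (val y)) (Sum.elim (val x') (val y'))) :
    x < y ↔ x' < y' := by
  obtain ⟨E, hE, hlt⟩ := h.lt_iff
  rw [hlt, hlt]
  exact hxy E (hE.mono hAB)

theorem le_congr (h : IsOrderedLocus L A val) (hAB : A ⊆ B) {x y x' y' : X}
    (hxy : EqType L B (Sum.elim (val x) (val y)) (Sum.elim (val x') (val y'))) :
    x ≤ y ↔ x' ≤ y' := by
  rw [← not_lt, ← not_lt, h.lt_congr hAB hxy.swap]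

/-- Types over small sets have convex loci. -/
theorem eqType_of_between (h : IsOrderedLocus L A val) (hAB : A ⊆ B) (hB : (B \ A).Finite)
    {x y z : X} (hxy : x ≤ y) (hyz : y ≤ z) (hxz : EqType L B (val x) (val z)) :
    EqType L B (val x) (val y) := by
  refine EqType.symm (EqType.of_imp fun D hD hy => ?_)
  by_contra hx
  have hxy : x < y := hxy.lt_of_ne (by rintro rfl; exact hx hy)
  have hyz : y < z := hyz.lt_of_ne (by rintro rfl; exact hx ((hxz D hD).2 hy))
  -- The pattern `x < y < z` is copied to start at any conjugate `t` of `x`. Its right end is again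
  -- a conjugate of `x`, so copies can be chained into an infinite alternation of `D`.
  have step : ∀ t : {t : X // EqType L B (val x) (val t)},
      ∃ p : X × {t : X // EqType L B (val x) (val t)}, t.1 < p.1 ∧ p.1 < p.2.1 ∧ val p.1 ∈ D := by
    rintro ⟨t, ht⟩
    obtain ⟨y', hy'⟩ := h.extend hAB hB ht y
    obtain ⟨z', hz'⟩ := h.extend hAB hB hy' z
    have h1 := hz'.comp (Sum.map id Sum.inl : Fin n ⊕ Fin n → Fin n ⊕ (Fin n ⊕ Fin n))
    simp only [Sum.elim_comp_map, Function.comp_id, Sum.elim_comp_inl] at h1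
    exact ⟨⟨y', z', hxz.trans h1.left⟩, (h.lt_congr hAB hy'.swap).1 hxy,
      (h.lt_congr hAB h1.swap).1 hyz, (hy'.left D hD).1 hy⟩
  choose f hf1 hf2 hf3 using step
  let s : ℕ → {t : X // EqType L B (val x) (val t)} :=
    fun i => Nat.rec ⟨x, EqType.refl B _⟩ (fun _ t => (f t).2) i
  exact h.not_alternating D (hD.mono (Set.subset_univ _)) (fun i => (s i).1) (fun i => (f (s i)).1)
    (fun i => ⟨fun hc => hx (((s i).2 D hD).2 hc), hf3 _⟩)
    (Or.inl fun i => ⟨hf1 _, hf2 _⟩)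

/-- Completeness of the right globalization: if `D` and its complement were both cofinal, one could
climb through them alternately forever. -/
theorem rightEventual_or_compl (h : IsOrderedLocus L A val) [Nonempty X] {D : Set (Fin n → M)}
    (hD : (Set.univ : Set M).Definable L D) :
    RightEventual (val ⁻¹' D) ∨ RightEventual (val ⁻¹' Dᶜ) := by
  by_contra! H
  simp only [rightEventual_iff, not_exists, not_forall, Set.mem_preimage, Set.mem_compl_iff,
    not_not] at H
  obtain ⟨H1, H2⟩ := H
  choose g hg hgD using H1
  choose f hf hfD using H2
  obtain ⟨x⟩ := ‹Nonempty X›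
  let s : ℕ → X := fun i => Nat.rec (g x) (fun _ t => g (f t)) i
  have hs : ∀ i, val (s i) ∉ D := fun i => by cases i <;> exact hgD _
  refine h.not_alternating D hD s (fun i => f (s i)) (fun i => ⟨hs i, hfD _⟩)
    (Or.inl fun i => ⟨(hf _).lt_of_ne fun e => hs i ?_, (hg _).lt_of_ne fun e => hs (i + 1) ?_⟩)
  · rw [e]; exact hfD _
  · change val (g (f (s i))) ∈ D
    rw [← e]; exact hfD _

theorem rightEventual_sUnion (h : IsOrderedLocus L A val) [Nonempty X] {F : Set (Set (Fin n → M))}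
    (hF : F.Finite) (hdef : ∀ D ∈ F, (Set.univ : Set M).Definable L D)
    (hU : RightEventual (val ⁻¹' ⋃₀ F)) : ∃ D ∈ F, RightEventual (val ⁻¹' D) := by
  by_contra! H
  have hcompl : ∀ D ∈ F, ∃ u, ∀ y, u ≤ y → val y ∉ D := fun D hD =>
    rightEventual_iff.1 ((h.rightEventual_or_compl (hdef D hD)).resolve_left (H D hD))
  have : ∀ᶠ u in Filter.atTop, ∀ D ∈ F, val u ∉ D :=
    (Filter.eventually_all_finite hF).2 fun D hD =>
      Filter.eventually_atTop.2 (hcompl D hD)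
  obtain ⟨u, hu⟩ := Filter.eventually_atTop.1 this
  obtain ⟨w, hw⟩ := rightEventual_iff.1 hU
  obtain ⟨D, hD, hmem⟩ := hw (max u w) (le_max_right _ _)
  exact hu _ (le_max_left _ _) D hD hmem

theorem exists_rightGeneric (h : IsOrderedLocus L A val) (hAB : A ⊆ B) (hB : (B \ A).Finite)
    (e : X) : ∃ x, e ≤ x ∧ RightGeneric L val B x := by
  obtain ⟨E, hE, hlt⟩ := h.lt_iff
  -- Adding `e` to the parameters makes `e ≤ x` one of the right-eventual conditions to be realized.
  have hfin := finite_union_range_sdiff hB (val e)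
  obtain ⟨x, hx⟩ := h.realize e (B ∪ Set.range (val e)) (hAB.trans Set.subset_union_left) hfin
    {D | (B ∪ Set.range (val e)).Definable L D ∧ RightEventual (val ⁻¹' D)}
    ⟨Set.univ, Set.definable_univ, rightEventual_iff.2 ⟨e, fun _ _ => trivial⟩⟩
    (by
      rintro D ⟨hD, hD'⟩ D₂ ⟨hD₂, hD₂'⟩
      obtain ⟨u, hu⟩ := rightEventual_iff.1 hD'
      obtain ⟨v, hv⟩ := rightEventual_iff.1 hD₂'
      exact ⟨hD.inter hD₂, rightEventual_iff.2 ⟨max u v, fun y hy =>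
        ⟨hu y ((le_max_left _ _).trans hy), hv y ((le_max_right _ _).trans hy)⟩⟩⟩)
    (fun D hD => hD.1)
    (by
      rintro D ⟨-, hD⟩ E' - hsub
      obtain ⟨u, hu⟩ := rightEventual_iff.1 hD
      exact ⟨val u, hu u le_rfl, hsub ⟨u, rfl⟩⟩)
  refine ⟨x, ?_, fun D hD hD' => hx D ⟨hD.mono Set.subset_union_left, hD'⟩⟩
  have := hx {t | Sum.elim t (val e) ∈ Eᶜ}
    ⟨definable_union_range_iff.2 ⟨_, (hE.mono hAB).compl, rfl⟩,
      rightEventual_iff.2 ⟨e, fun y hy => fun hc => hy.not_gt ((hlt _ _).2 hc)⟩⟩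
  exact not_lt.1 fun hc => this ((hlt _ _).1 hc)

theorem eqType_of_rightGeneric (h : IsOrderedLocus L A val) {x y : X}
    (hx : RightGeneric L val B x) (hy : RightGeneric L val B y) :
    EqType L B (val x) (val y) := by
  have : Nonempty X := ⟨x⟩
  refine EqType.of_imp fun D hD hxD => ?_
  rcases h.rightEventual_or_compl (hD.mono (Set.subset_univ _)) with H | H
  · exact hy D hD H
  · exact absurd hxD (hx Dᶜ hD.compl H)

/-- There are generic elements above any `y`, so `y` is caught between two realizations of the same
type over `B`. -/
theorem rightGeneric_of_le (h : IsOrderedLocus L A val) (hAB : A ⊆ B) (hB : (B \ A).Finite)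
    {x y : X} (hx : RightGeneric L val B x) (hxy : x ≤ y) : RightGeneric L val B y := by
  obtain ⟨z, hyz, hz⟩ := h.exists_rightGeneric hAB hB y
  exact hx.congr (h.eqType_of_between hAB hB hxy hyz (h.eqType_of_rightGeneric hx hz))

theorem le_of_rightGeneric (h : IsOrderedLocus L A val) (hAB : A ⊆ B) (hB : (B \ A).Finite)
    {x y : X} (hy : RightGeneric L val (B ∪ Set.range (val x)) y) : x ≤ y := by
  have hfin := finite_union_range_sdiff hB (val x)
  obtain ⟨z, hxz, hz⟩ :=
    h.exists_rightGeneric (hAB.trans (Set.subset_union_left (t := Set.range (val x)))) hfin x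
  have := (eqType_union_range_iff.1 (h.eqType_of_rightGeneric hz hy)).swap
  exact (h.le_congr hAB this).1 hxz

/-- Invariance of the right globalization: a bound `u` witnessing eventuality for `v` is transported
to `u'` for `w`, and each element above `u'` is pulled back to one above `u`. -/
theorem rightEventual_congr (h : IsOrderedLocus L A val) (hAB : A ⊆ B) (hB : (B \ A).Finite)
    {ι : Type*} [Finite ι] {v w : ι → M} (hvw : EqType L B v w) {E : Set (Fin n ⊕ ι → M)}
    (hE : B.Definable L E) (hv : RightEventual (val ⁻¹' {x | Sum.elim x v ∈ E})) :
    RightEventual (val ⁻¹' {x | Sum.elim x w ∈ E}) := by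
  rw [rightEventual_iff] at hv ⊢
  obtain ⟨u, hu⟩ := hv
  obtain ⟨u', hu'⟩ := h.extend hAB hB hvw u
  refine ⟨u', fun t' ht' => ?_⟩
  obtain ⟨t, ht⟩ := h.extend hAB hB hu'.symm t'
  have h1 := ht.comp (Sum.map id Sum.inl : Fin n ⊕ Fin n → Fin n ⊕ (Fin n ⊕ ι))
  have h2 := ht.comp (Sum.map id Sum.inr : Fin n ⊕ ι → Fin n ⊕ (Fin n ⊕ ι))
  simp only [Sum.elim_comp_map, Function.comp_id, Sum.elim_comp_inl, Sum.elim_comp_inr] at h1 h2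
  exact (h2 E hE).2 (hu t ((h.le_congr hAB h1.swap).1 ht'))

theorem rightGeneric_congr (h : IsOrderedLocus L A val) (hAB : A ⊆ B) (hB : (B \ A).Finite)
    {c y c' y' : X} (hcy : EqType L B (Sum.elim (val c) (val y)) (Sum.elim (val c') (val y')))
    (hc : RightGeneric L val (B ∪ Set.range (val y)) c) :
    RightGeneric L val (B ∪ Set.range (val y')) c' := by
  intro D hD hD'
  obtain ⟨E, hE, rfl⟩ := definable_union_range_iff.1 hD
  exact (hcy E hE).1 (hc _ (definable_union_range_iff.2 ⟨E, hE, rfl⟩)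
    (h.rightEventual_congr hAB hB hcy.right.symm hE hD'))

/-- A formula whose solution set contains a final part of the locus does not fork. -/
theorem not_formulaForks_of_rightEventual (h : IsOrderedLocus L A val) {D : Set (Fin n → M)}
    (hD : RightEventual (val ⁻¹' D)) : ¬ FormulaForks L A D := by
  rintro ⟨F, hF, hdiv, hsub⟩
  obtain ⟨u, hu⟩ := rightEventual_iff.1 hD
  have : Nonempty X := ⟨u⟩
  have hdef : ∀ {m : ℕ} (φ : L.Formula (Fin n ⊕ Fin m)),
      A.Definable L {x : Fin n ⊕ Fin m → M | φ.Realize x} := fun φ =>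
    (Set.empty_definable_iff.2 ⟨φ, rfl⟩).mono (Set.empty_subset _)
  obtain ⟨E, hE, hE'⟩ := h.rightEventual_sUnion hF
    (by
      intro E hE
      obtain ⟨m, φ, b, -, rfl⟩ := hdiv E hE
      refine Set.Definable.mono (definable_union_range_iff.2 ⟨_, hdef φ, rfl⟩)
        (Set.subset_univ _))
    (rightEventual_iff.2 ⟨u, fun y hy => hsub (hu y hy)⟩)
  obtain ⟨m, φ, b, ⟨k, s, hs, hk⟩, rfl⟩ := hdiv E hE
  have hev : ∀ i, ∀ᶠ y in Filter.atTop, φ.Realize (Sum.elim (val y) (s i)) := fun i =>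
    Filter.eventually_atTop.2 (rightEventual_iff.1
      (h.rightEventual_congr subset_rfl (by simp) (EqType.symm (hs i)) (hdef φ) hE'))
  -- The first `k` conjugates all contain final parts, hence have a common point, against
  -- `k`-inconsistency.
  obtain ⟨y, hy⟩ := ((Filter.eventually_all_finset (Finset.range k)).2 fun i _ => hev i).exists
  exact hk (Finset.range k) (Finset.card_range k) ⟨val y, hy⟩

end IsOrderedLocus

end OrderedLocus

/-! ### Parameters coming from finite lists. -/

section ListParams

variable {M X : Type*} {A : Set M} {n : ℕ} {val : X → Fin n → M}

/-- `A` together with the coordinates of the terms of `l`. -/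
def listParams (A : Set M) (val : X → Fin n → M) (l : List X) : Set M :=
  A ∪ {m | ∃ x ∈ l, m ∈ Set.range (val x)}

theorem subset_listParams (l : List X) : A ⊆ listParams A val l := Set.subset_union_left

theorem finite_listParams_sdiff (l : List X) : (listParams A val l \ A).Finite := by
  have : (⋃ x ∈ l, Set.range (val x)).Finite :=
    (List.finite_toSet l).biUnion fun x _ => Set.finite_range _
  refine this.subset ?_
  rintro m ⟨hm | ⟨x, hx, hm⟩, hA⟩
  · exact absurd hm hA
  · exact Set.mem_biUnion hx hm

theorem listParams_nil : listParams A val [] = A := by simp [listParams]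

theorem listParams_mono {l l' : List X} (h : l ⊆ l') : listParams A val l ⊆ listParams A val l' :=
  Set.union_subset_union_right _ fun _ ⟨x, hx, hm⟩ => ⟨x, h hx, hm⟩

theorem listParams_append_cons (l₁ l₂ : List X) (y : X) :
    listParams A val (l₁ ++ y :: l₂) = listParams A val (l₁ ++ l₂) ∪ Set.range (val y) := by
  ext m
  simp only [listParams, List.mem_append, List.mem_cons, Set.mem_union, Set.mem_ofPred_eq]
  grind

theorem listParams_cons (l : List X) (y : X) :
    listParams A val (y :: l) = listParams A val l ∪ Set.range (val y) :=
  listParams_append_cons [] l y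

end ListParams

/-! ### Finite Morley sequences: uniqueness, convexity, insertion and replacement. -/

section FiniteMorley

variable {L : FirstOrder.Language} {M : Type*} [L.Structure M]
  {A : Set M} {n : ℕ} {X : Type*} [LinearOrder X] {val : X → Fin n → M}

/-- `l`, read from its last entry to its head, is a Morley sequence in the right globalization. -/
def MorleyList (L : FirstOrder.Language) {M : Type*} [L.Structure M] (A : Set M) {n : ℕ}
    {X : Type*} [LinearOrder X] (val : X → Fin n → M) : List X → Prop
  | [] => True
  | x :: l => RightGeneric L val (listParams A val l) x ∧ MorleyList L A val l

theorem MorleyList.sublist {l l' : List X} (hl : l.Sublist l') (h : MorleyList L A val l') :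
    MorleyList L A val l := by
  induction hl with
  | slnil => exact h
  | cons _ _ ih => exact ih h.2
  | cons_cons _ hs ih => exact ⟨h.1.mono (listParams_mono hs.subset), ih h.2⟩

namespace IsOrderedLocus

variable {l₁ l₂ : List X} {x y z u : X}

theorem morleyList_congr (h : IsOrderedLocus L A val) (hy : MorleyList L A val (l₁ ++ y :: l₂))
    (hyz : EqType L (listParams A val (l₁ ++ l₂)) (val y) (val z)) :
    MorleyList L A val (l₁ ++ z :: l₂) := by
  induction l₁ with
  | nil => exact ⟨hy.1.congr hyz, hy.2⟩
  | cons c l ih =>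
    rw [List.cons_append] at hy hyz ⊢
    obtain ⟨hc, hy⟩ := hy
    refine ⟨?_, ih hy (hyz.mono (listParams_mono (List.subset_cons_self _ _)))⟩
    rw [listParams_append_cons] at hc ⊢
    rw [listParams_cons, eqType_union_range_iff] at hyz
    exact h.rightGeneric_congr (subset_listParams _) (finite_listParams_sdiff _) hyz.swap hc

/-- Over the other terms, the type of a term of a Morley sequence is determined by its place. -/
theorem eqType_of_morleyList (h : IsOrderedLocus L A val)
    (hy : MorleyList L A val (l₁ ++ y :: l₂)) (hz : MorleyList L A val (l₁ ++ z :: l₂)) :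
    EqType L (listParams A val (l₁ ++ l₂)) (val y) (val z) := by
  induction l₁ with
  | nil => exact h.eqType_of_rightGeneric hy.1 hz.1
  | cons c l ih =>
    rw [List.cons_append] at hy hz
    obtain ⟨hc, hy⟩ := hy
    obtain ⟨hc', hz⟩ := hz
    have hAB := subset_listParams (A := A) (val := val) (l ++ l₂)
    have hB := finite_listParams_sdiff (A := A) (val := val) (l ++ l₂)
    -- Transport `c` along `y ↦ z`. Both `c'` and `c` are then generic over the remaining terms and
    -- `z`, so `(c, y)`, `(c', z)` and `(c, z)` have the same type.
    obtain ⟨c', hcc'⟩ := h.extend hAB hB (ih hy hz) c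
    rw [listParams_append_cons] at hc hc'
    have := h.eqType_of_rightGeneric (h.rightGeneric_congr hAB hB hcc' hc) hc'
    rw [eqType_union_range_iff] at this
    rw [List.cons_append, listParams_cons, eqType_union_range_iff]
    exact (hcc'.trans this).swap

/-- The elements that can be inserted at a given place of a Morley sequence form a convex set. -/
theorem morleyList_of_between (h : IsOrderedLocus L A val)
    (hx : MorleyList L A val (l₁ ++ x :: l₂)) (hz : MorleyList L A val (l₁ ++ z :: l₂))
    (hxy : x ≤ y) (hyz : y ≤ z) : MorleyList L A val (l₁ ++ y :: l₂) :=
  h.morleyList_congr hx (h.eqType_of_between (subset_listParams _) (finite_listParams_sdiff _)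
    hxy hyz (h.eqType_of_morleyList hx hz))

theorem exists_morleyList_insert (h : IsOrderedLocus L A val) [Nonempty X]
    (hl : MorleyList L A val (l₁ ++ l₂)) : ∃ y, MorleyList L A val (l₁ ++ y :: l₂) := by
  obtain ⟨x₀⟩ := ‹Nonempty X›
  induction l₁ with
  | nil =>
    obtain ⟨y, -, hy⟩ := h.exists_rightGeneric (subset_listParams (val := val) l₂)
      (finite_listParams_sdiff _) x₀
    exact ⟨y, hy, hl⟩
  | cons c l ih =>
    rw [List.cons_append] at hl
    obtain ⟨hc, hl⟩ := hl
    obtain ⟨y, hy⟩ := ih hl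
    have hAB := subset_listParams (A := A) (val := val) (l ++ l₂)
    have hB := finite_listParams_sdiff (A := A) (val := val) (l ++ l₂)
    -- `c` need not be generic over `y`. A new `c'` is, and conjugating `c'` back to `c` over the
    -- other terms moves `y` to a suitable `y'`.
    obtain ⟨c', -, hc'⟩ := h.exists_rightGeneric (subset_listParams (val := val) (l ++ y :: l₂))
      (finite_listParams_sdiff _) x₀
    rw [listParams_append_cons] at hc'
    obtain ⟨y', hy'⟩ := h.extend hAB hB
      (h.eqType_of_rightGeneric (hc'.mono Set.subset_union_left) hc) y
    refine ⟨y', ?_⟩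
    rw [List.cons_append]
    refine ⟨?_, h.morleyList_congr hy hy'.left⟩
    rw [listParams_append_cons]
    exact h.rightGeneric_congr hAB hB hy'.swap hc'

theorem head_ge_of_morleyList (h : IsOrderedLocus L A val)
    (hl : MorleyList L A val (y :: x :: l₂)) : x ≤ y := by
  have := hl.1
  rw [listParams_cons] at this
  exact h.le_of_rightGeneric (subset_listParams _) (finite_listParams_sdiff _) this

/-- Take `w` over which `y` is generic. Since `x ≥ u ≥ y`, `x` is generic over `w` too, and `w ≤ y ≤
u` puts `y` between two elements that can precede `x`. This makes the elements that can precede `x`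
an initial part. -/
theorem morleyList_pair_of_le (h : IsOrderedLocus L A val) (hx : MorleyList L A val [x, u])
    (hyu : y ≤ u) : MorleyList L A val [x, y] := by
  have hAB := subset_listParams (A := A) (val := val) []
  have hB := finite_listParams_sdiff (A := A) (val := val) []
  have generic : ∀ w, MorleyList L A val [w] := fun w => by
    obtain ⟨v, -, hv⟩ := h.exists_rightGeneric hAB hB w
    exact ⟨hv.congr (by rw [listParams_nil]; exact h.same _ _), trivial⟩
  have pair : ∀ v w, MorleyList L A val [v, w] ↔
      RightGeneric L val (listParams A val [] ∪ Set.range (val w)) v := fun v w => by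
    rw [← listParams_cons]
    exact ⟨fun H => H.1, fun H => ⟨H, generic w⟩⟩
  have : Nonempty X := ⟨x⟩
  -- `w` is the second coordinate of a conjugate of `(d, y)` whose first coordinate is `y`.
  obtain ⟨d, hd⟩ := h.exists_morleyList_insert (l₁ := []) (generic y)
  obtain ⟨w, hw⟩ := h.extend hAB hB
    (show EqType L (listParams A val []) (val d) (val y) by
      rw [listParams_nil]; exact h.same _ _) y
  have hyw : MorleyList L A val [y, w] :=
    (pair _ _).2 (h.rightGeneric_congr hAB hB hw.swap ((pair _ _).1 hd))
  have hux := h.head_ge_of_morleyList hx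
  have hxw : MorleyList L A val [x, w] :=
    (pair _ _).2 (h.rightGeneric_of_le (hAB.trans Set.subset_union_left)
      (finite_union_range_sdiff hB _) ((pair _ _).1 hyw) (hyu.trans hux))
  exact h.morleyList_of_between (l₁ := [x]) (l₂ := []) hxw hx (h.head_ge_of_morleyList hyw) hyu

/-- If `y < u`, then everything up to `u` has the type of `y` over `A` and `x`. Each formula of that
type contains an initial part, so it does not fork, by the final-part criterion in the reversed
order. -/
theorem le_of_forkDependent_of_morleyList_left (h : IsOrderedLocus L A val)
    (hu : MorleyList L A val [x, u]) (hy : ¬ ForkIndep L A (val y) (Set.range (val x))) :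
    u ≤ y := by
  by_contra! hyu
  obtain ⟨D, hD, hyD, hf⟩ := not_not.1 hy
  have key : ∀ w, w ≤ u → EqType L (A ∪ Set.range (val x)) (val y) (val w) := fun w hw => by
    have := h.eqType_of_morleyList (l₁ := [x]) (l₂ := [])
      (h.morleyList_pair_of_le hu hyu.le) (h.morleyList_pair_of_le hu hw)
    rwa [List.append_nil, listParams_cons, listParams_nil] at this
  refine h.dual.not_formulaForks_of_rightEventual (rightEventual_iff.2
    ⟨OrderDual.toDual u, fun w hw => ?_⟩) hf
  exact (key (OrderDual.ofDual w) hw D hD).1 hyD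

theorem le_of_forkDependent_of_morleyList_right (h : IsOrderedLocus L A val)
    (hz : MorleyList L A val [z, x]) (hy : ¬ ForkIndep L A (val y) (Set.range (val x))) :
    y ≤ z := by
  by_contra! hzy
  obtain ⟨D, hD, hyD, hf⟩ := not_not.1 hy
  have hz' : RightGeneric L val (A ∪ Set.range (val x)) z := by
    have := hz.1
    rwa [listParams_cons, listParams_nil] at this
  have key : ∀ w, z ≤ w → RightGeneric L val (A ∪ Set.range (val x)) w := fun w hw =>
    h.rightGeneric_of_le Set.subset_union_left (finite_union_range_sdiff (by simp) _) hz' hw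
  exact h.not_formulaForks_of_rightEventual (rightEventual_iff.2 ⟨z, fun w hw =>
    (h.eqType_of_rightGeneric (key y hzy.le) (key w hw) D hD).1 hyD⟩) hf

/-- Neighbours `u` and `v` of `x` enclose `y`; after dropping `x`, each of them can occupy its
place, and convexity passes this on to `y`. -/
theorem morleyList_replace (h : IsOrderedLocus L A val)
    (hx : MorleyList L A val (l₁ ++ x :: l₂))
    (hy : ¬ ForkIndep L A (val y) (Set.range (val x))) :
    MorleyList L A val (l₁ ++ y :: l₂) := by
  have : Nonempty X := ⟨x⟩
  obtain ⟨u, hu⟩ := h.exists_morleyList_insert (l₁ := l₁ ++ [x]) (l₂ := l₂) (by simpa using hx)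
  obtain ⟨v, hv⟩ := h.exists_morleyList_insert (l₁ := l₁) (l₂ := x :: u :: l₂) (by simpa using hu)
  have sub : ∀ {l}, l.Sublist (v :: x :: u :: l₂) → MorleyList L A val (l₁ ++ l) := fun hl =>
    hv.sublist (hl.append_left l₁)
  refine h.morleyList_of_between (sub (l := u :: l₂) (by simp)) (sub (l := v :: l₂) (by simp))
    (h.le_of_forkDependent_of_morleyList_left
      (hv.sublist (l := [x, u]) (List.Sublist.trans ?_ (List.sublist_append_right _ _))) hy)
    (h.le_of_forkDependent_of_morleyList_right
      (hv.sublist (l := [v, x]) (List.Sublist.trans ?_ (List.sublist_append_right _ _))) hy)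
  · simp
  · simp

theorem morleyList_of_forkDependent {J : Type*} (h : IsOrderedLocus L A val) {a a' : J → X}
    (ha' : ∀ j, ¬ ForkIndep L A (val (a' j)) (Set.range (val (a j)))) (js : List J)
    (l : List X) (hl : MorleyList L A val (l ++ js.map a)) :
    MorleyList L A val (l ++ js.map a') := by
  induction js generalizing l with
  | nil => exact hl
  | cons j js ih =>
    -- The prefix `l` holds the terms already replaced, which makes the induction proceed one term
    -- at a time.
    have := ih (l ++ [a' j]) (by simpa using h.morleyList_replace hl (ha' j))
    simpa using this

end IsOrderedLocus

end FiniteMorley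

/-! ### The locus of a weakly o-minimal pair in a saturated model. -/

section Locus

variable {L : FirstOrder.Language} {M : Type*} [L.Structure M] {A : Set M} {n : ℕ}

theorem eqType_of_mem_locus {p : TypesOver L A n} {x y : Fin n → M} (hx : x ∈ locus p)
    (hy : y ∈ locus p) : EqType L A x y := by
  refine EqType.of_imp ?_
  rintro _ ⟨φ, rfl⟩ hφ
  rcases p.mem_or_not_mem (Formula.equivSentence φ) with H | H
  · exact hy φ H
  · exact absurd hφ (hx φ.not H)

theorem mem_locus_of_eqType {p : TypesOver L A n} {x y : Fin n → M} (hx : x ∈ locus p)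
    (h : EqType L A x y) : y ∈ locus p :=
  fun φ hφ => (h {v | φ.Realize v} ⟨φ, rfl⟩).1 (hx φ hφ)

theorem exists_isConvexComponent {X : Type*} [LinearOrder X] {D : Set X} {x : X} (hx : x ∈ D) :
    ∃ C, IsConvexComponent D C ∧ x ∈ C := by
  refine ⟨D.ordConnectedComponent x, ⟨⟨inferInstance, Set.ordConnectedComponent_subset⟩, ?_⟩,
    Set.mem_ordConnectedComponent.2 (by simpa using hx)⟩
  rintro C ⟨hC, hCD⟩ hsub z hz
  exact Set.mem_ordConnectedComponent.2 ((hC.uIcc_subset (hsub (by simpa using hx)) hz).trans hCD)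

/-- The points `y i` lie in pairwise distinct components, since `t (i + 1)` outside `D` separates `y
i` from every later `y j`. -/
theorem not_alternating_of_finite_components {X : Type*} [LinearOrder X] {D : Set X}
    (hD : {C | IsConvexComponent D C}.Finite) (t y : ℕ → X) (hty : ∀ i, t i ∉ D ∧ y i ∈ D)
    (h : ∀ i j, i < j → t (i + 1) ∈ Set.uIcc (y i) (y j)) : False := by
  choose C hC hyC using fun i => exists_isConvexComponent (hty i).2
  refine Set.infinite_of_injective_forall_mem (f := C) ?_ hC hD
  intro i j hij
  by_contra hne
  wlog hlt : i < j generalizing i j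
  · exact this hij.symm (Ne.symm hne) (lt_of_le_of_ne (not_lt.1 hlt) (Ne.symm hne))
  exact (hty (i + 1)).1 ((hC i).prop.2 ((hC i).prop.1.uIcc_subset (hyC i) (hij ▸ hyC j) (h i j hlt)))

/-- Saturation over sets that differ from the small set `A` by finitely many elements. -/
theorem IsSaturatedModel.realizes_of_finite_sdiff {S : Type*} {sort : M → S}
    (hM : IsSaturatedModel L M sort) (hA : Cardinal.mk A < Cardinal.mk M) {B : Set M}
    (hB : (B \ A).Finite) {k : ℕ} (σ : Fin k → S) (F : Set (Set (Fin k → M)))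
    (hF : ∀ D ∈ F, B.Definable L D)
    (hfin : ∀ G ⊆ F, G.Finite → ∃ x : Fin k → M, sort ∘ x = σ ∧ ∀ D ∈ G, x ∈ D) :
    ∃ x : Fin k → M, sort ∘ x = σ ∧ ∀ D ∈ F, x ∈ D := by
  -- For finite `M`, `B` may be as large as `M`, but then `F` is itself finite.
  rcases finite_or_infinite M with hfinite | hinf
  · exact hfin F subset_rfl (Set.toFinite F)
  · refine hM.realizes B ?_ k σ F hF hfin
    have h1 : Cardinal.mk B ≤ Cardinal.mk A + Cardinal.mk ↥(B \ A) :=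
      (Cardinal.mk_le_mk_of_subset (by simp : B ⊆ A ∪ B \ A)).trans (Cardinal.mk_union_le _ _)
    exact h1.trans_lt (Cardinal.add_lt_of_lt (Cardinal.aleph0_le_mk M) hA
      ((Cardinal.lt_aleph0_iff_set_finite.2 hB).trans_le (Cardinal.aleph0_le_mk M)))

theorem IsSaturatedModel.definable_sort_comp_eq {S : Type*} {sort : M → S}
    (hM : IsSaturatedModel L M sort) (B : Set M) {k : ℕ} (σ : Fin k → S) :
    B.Definable L {x : Fin k → M | sort ∘ x = σ} := by
  have : ∀ i, B.Definable L {x : Fin k → M | sort (x i) = σ i} := fun i =>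
    (Set.Definable.preimage_comp (fun _ : Fin 1 => i) (hM.definable_sort (σ i))).mono
      (Set.empty_subset _)
  convert Set.definable_iInter_of_finite this using 1
  ext x
  simp [funext_iff]

theorem IsWeaklyOMinimalPair.isOrderedLocus {S : Type*} {sort : M → S}
    (hM : IsSaturatedModel L M sort) (hA : Cardinal.mk A < Cardinal.mk M)
    {p : TypesOver L A n} [LinearOrder (locus p)] (hp : IsWeaklyOMinimalPair p) :
    IsOrderedLocus L A (Subtype.val : locus p → Fin n → M) where
  same x y := eqType_of_mem_locus x.2 y.2
  lt_iff := hp.relDefinable_lt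
  not_alternating D hD t y hty h := by
    refine not_alternating_of_finite_components (hp.finite_components D hD) t y hty fun i j hij => ?_
    rcases h with h | h
    · have hy : StrictMono y := strictMono_nat_of_lt_succ fun i => (h i).2.trans (h (i + 1)).1
      exact Set.mem_uIcc.2 (Or.inl ⟨(h i).2.le, ((h _).1.trans_le (hy.monotone hij)).le⟩)
    · have hy : StrictAnti y := strictAnti_nat_of_succ_lt fun i => (h (i + 1)).1.trans (h i).2
      exact Set.mem_uIcc.2 (Or.inr ⟨((hy.antitone hij).trans_lt (h _).1).le, (h i).2.le⟩)
  realize e B hAB hB F hF hI hdef hsat := by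
    have hrange : ∀ E : Set (Fin n → M), A.Definable L E → e.1 ∈ E →
        Set.range (Subtype.val : locus p → Fin n → M) ⊆ E := by
      rintro E hE he _ ⟨x, rfl⟩
      exact (eqType_of_mem_locus e.2 x.2 E hE).1 he
    -- Adding the type of `e` over `A` forces the realization into the locus. That type also fixes
    -- the sorts, as these are definable.
    obtain ⟨x, -, hx⟩ := hM.realizes_of_finite_sdiff hA hB (sort ∘ e.1)
      (F ∪ {E | A.Definable L E ∧ e.1 ∈ E})
      (by
        rintro D (hD | hD)
        exacts [hdef D hD, hD.1.mono hAB])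
      (by
        intro G hG hGf
        obtain ⟨D, hD, E, hE, heE, hDE⟩ : ∃ D ∈ F, ∃ E, A.Definable L E ∧ e.1 ∈ E ∧
            D ∩ E ⊆ ⋂₀ G := by
          induction G, hGf using Set.Finite.induction_on with
          | empty =>
            obtain ⟨D, hD⟩ := hF
            exact ⟨D, hD, Set.univ, Set.definable_univ, trivial, by simp⟩
          | @insert C G _ _ ih =>
            obtain ⟨D, hD, E, hE, heE, hDE⟩ := ih ((Set.subset_insert _ _).trans hG)
            rw [Set.sInter_insert]
            rcases hG (Set.mem_insert _ _) with hC | hC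
            · exact ⟨C ∩ D, hI C hC D hD, E, hE, heE, fun x hx => ⟨hx.1.1, hDE ⟨hx.1.2, hx.2⟩⟩⟩
            · exact ⟨D, hD, C ∩ E, hC.1.inter hE, ⟨hC.2, heE⟩,
                fun x hx => ⟨hx.2.1, hDE ⟨hx.1, hx.2.2⟩⟩⟩
        obtain ⟨x, hxD, hxE, hxs⟩ := hsat D hD (E ∩ {x | sort ∘ x = sort ∘ e.1})
          (hE.inter (hM.definable_sort_comp_eq A _)) (hrange _
            (hE.inter (hM.definable_sort_comp_eq A _)) ⟨heE, rfl⟩)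
        exact ⟨x, hxs, fun C hC => hDE ⟨hxD, hxE⟩ C hC⟩)
    refine ⟨⟨x, mem_locus_of_eqType e.2 (EqType.of_imp fun E hE he => hx E (Or.inr ⟨hE, he⟩))⟩,
      fun D hD => hx D (Or.inl hD)⟩

end Locus

/-! ### Reduction of arbitrary Morley sequences to finite ones. -/

section MorleySequences

variable {L : FirstOrder.Language} {M : Type*} [L.Structure M] {A : Set M} {n : ℕ}
  {p : TypesOver L A n} [LinearOrder (locus p)] {J : Type*} [LinearOrder J]

theorem realizesRestriction_iff_rightGeneric {B : Set M} {x : locus p} :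
    RealizesRestriction L (rightGlobalization p) B x.1 ↔ RightGeneric L Subtype.val B x :=
  ⟨fun h D hD hE => h D ⟨hD.mono (Set.subset_univ _), hE⟩ hD, fun h D hD hB => h D hB hD.2⟩

/-- Being a Morley sequence is checked on finitely many earlier terms at a time. -/
theorem isMorleySeq_of_finite {a : J → locus p}
    (h : ∀ k : J, ∀ s : Finset J, (∀ i ∈ s, i < k) →
      RightGeneric L Subtype.val (A ∪ ⋃ i ∈ s, Set.range (a i).1) (a k)) :
    IsMorleySeq L (rightGlobalization p) A (fun j => (a j).1) := by
  classical
  intro k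
  rw [realizesRestriction_iff_rightGeneric]
  intro D hD hD'
  obtain ⟨A₀, hA₀, hD₀⟩ := Set.definable_iff_finitely_definable.1 hD
  have : ∀ m ∈ A₀, ∃ s : Finset J, (∀ i ∈ s, i < k) ∧ m ∈ A ∪ ⋃ i ∈ s, Set.range (a i).1 := by
    intro m hm
    rcases hA₀ hm with hm | hm
    · exact ⟨∅, by simp, Or.inl hm⟩
    · obtain ⟨i, hi, hmi⟩ := Set.mem_iUnion₂.1 hm
      exact ⟨{i}, by simpa using hi, Or.inr (by simpa using hmi)⟩
  choose! s hs hms using this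
  refine h k (A₀.biUnion s) (fun i hi => ?_) D (hD₀.mono fun m hm => ?_) hD'
  · obtain ⟨m, hm, hi⟩ := Finset.mem_biUnion.1 hi
    exact hs m hm i hi
  · refine Set.union_subset_union_right A ?_ (hms m hm)
    exact Set.biUnion_subset_biUnion_left fun i hi => Finset.mem_biUnion.2 ⟨m, hm, hi⟩

theorem IsMorleySeq.morleyList {a : J → locus p}
    (h : IsMorleySeq L (rightGlobalization p) A (fun j => (a j).1)) {js : List J}
    (hjs : js.Pairwise (· > ·)) : MorleyList L A (Subtype.val : locus p → _) (js.map a) := by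
  induction js with
  | nil => trivial
  | cons j js ih =>
    rw [List.pairwise_cons] at hjs
    refine ⟨(realizesRestriction_iff_rightGeneric.1 (h j)).mono ?_, ih hjs.2⟩
    refine Set.union_subset_union_right A ?_
    rintro m ⟨x, hx, hm⟩
    obtain ⟨i, hi, rfl⟩ := List.mem_map.1 hx
    exact Set.mem_biUnion (hjs.1 i hi) hm

theorem isMorleySeq_of_morleyList {a : J → locus p}
    (h : ∀ js : List J, js.Pairwise (· > ·) →
      MorleyList L A (Subtype.val : locus p → _) (js.map a)) :
    IsMorleySeq L (rightGlobalization p) A (fun j => (a j).1) := by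
  refine isMorleySeq_of_finite fun k s hs => ?_
  have := h (k :: s.sort (· ≥ ·))
    (List.pairwise_cons.2 ⟨fun i hi => hs i (by simpa using hi), s.sortedGT_sort.pairwise⟩)
  refine this.1.mono (Set.union_subset_union_right A ?_)
  refine Set.iUnion₂_subset fun i hi m hm => ⟨a i, List.mem_map_of_mem (by simpa using hi), hm⟩

theorem isMorleySeq_removeInsert {a : J → locus p} {R : Set J} {U : LowerSet J} {c : locus p}
    (ha : IsMorleySeq L (rightGlobalization p) A (fun j => (a j).1))
    (h : ∀ l₁ l₂ : List J, l₁.Pairwise (· > ·) → l₂.Pairwise (· > ·) →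
      (∀ j ∈ l₁, j ∉ U ∧ j ∉ R) → (∀ j ∈ l₂, j ∈ U ∧ j ∉ R) →
      MorleyList L A (Subtype.val : locus p → _) (l₁.map a ++ c :: l₂.map a)) :
    IsMorleySeq L (rightGlobalization p) A (fun t => (removeInsert a R U c t).1) := by
  classical
  refine isMorleySeq_of_finite (a := removeInsert a R U c) ?_
  intro k s hs
  -- `idx` recovers the original index of an old term and is empty at the inserted one.
  let idx : {j : J // j ∈ U ∧ j ∉ R} ⊕ₗ (Unit ⊕ₗ {j : J // j ∉ U ∧ j ∉ R}) → Finset J :=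
    fun t => Sum.elim (fun j => {j.1})
      (fun t' => Sum.elim (fun _ => ∅) (fun j => {j.1}) (ofLex t')) (ofLex t)
  have hidx : ∀ i ∈ s.biUnion idx, i ∉ R := by
    intro i hi
    obtain ⟨t, -, hi⟩ := Finset.mem_biUnion.1 hi
    rcases t with j | _ | j
    · exact (Finset.mem_singleton.1 hi) ▸ j.2.2
    · exact absurd hi (Finset.notMem_empty _)
    · exact (Finset.mem_singleton.1 hi) ▸ j.2.2
  let s₁ := (s.biUnion idx).filter (· ∉ U)
  let s₂ := (s.biUnion idx).filter (· ∈ U)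
  have hs₁ : ∀ j ∈ s₁.sort (· ≥ ·), j ∉ U ∧ j ∉ R := fun j hj => by
    have := Finset.mem_filter.1 ((Finset.mem_sort _).1 hj)
    exact ⟨this.2, hidx j this.1⟩
  have hs₂ : ∀ j ∈ s₂.sort (· ≥ ·), j ∈ U ∧ j ∉ R := fun j hj => by
    have := Finset.mem_filter.1 ((Finset.mem_sort _).1 hj)
    exact ⟨this.2, hidx j this.1⟩
  have mem₁ : ∀ j : {j : J // j ∉ U ∧ j ∉ R}, toLex (Sum.inr (toLex (Sum.inr j))) ∈ s →
      j.1 ∈ s₁ := fun j hj =>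
    Finset.mem_filter.2 ⟨Finset.mem_biUnion.2 ⟨_, hj, Finset.mem_singleton_self _⟩, j.2.1⟩
  have mem₂ : ∀ j : {j : J // j ∈ U ∧ j ∉ R}, toLex (Sum.inl j) ∈ s → j.1 ∈ s₂ := fun j hj =>
    Finset.mem_filter.2 ⟨Finset.mem_biUnion.2 ⟨_, hj, Finset.mem_singleton_self _⟩, j.2.1⟩
  have key : ∀ (l : List (locus p)), (∀ t ∈ s, removeInsert a R U c t ∈ l) →
      RightGeneric L Subtype.val (listParams A Subtype.val l) (removeInsert a R U c k) →
      RightGeneric L Subtype.val (A ∪ ⋃ i ∈ s, Set.range (removeInsert a R U c i).1)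
        (removeInsert a R U c k) := fun l hl H =>
    H.mono (Set.union_subset_union_right A (Set.iUnion₂_subset fun i hi m hm => ⟨_, hl i hi, hm⟩))
  rcases k with k | _ | k
  · have hlt : ∀ j ∈ s₂.sort (· ≥ ·), k.1 > j := by
      intro j hj
      obtain ⟨hj, hjU⟩ := Finset.mem_filter.1 ((Finset.mem_sort _).1 hj)
      obtain ⟨t, ht, hj⟩ := Finset.mem_biUnion.1 hj
      rcases t with i | _ | i
      · rw [Finset.mem_singleton.1 hj]
        exact (Sum.Lex.inl_lt_inl_iff.1 (hs _ ht) : i < k)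
      · exact absurd hj (Finset.notMem_empty _)
      · exact absurd hjU ((Finset.mem_singleton.1 hj) ▸ i.2.1)
    refine key ((s₂.sort (· ≥ ·)).map a) ?_
      (ha.morleyList (List.pairwise_cons.2 ⟨hlt, s₂.sortedGT_sort.pairwise⟩)).1
    intro t ht
    rcases t with i | i
    · exact List.mem_map_of_mem ((Finset.mem_sort _).2 (mem₂ i ht))
    · exact absurd (hs _ ht) Sum.Lex.not_inr_lt_inl
  · refine key ((s₂.sort (· ≥ ·)).map a) ?_
      (h [] _ List.Pairwise.nil s₂.sortedGT_sort.pairwise (by simp) hs₂).1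
    intro t ht
    rcases t with i | _ | i
    · exact List.mem_map_of_mem ((Finset.mem_sort _).2 (mem₂ i ht))
    · exact absurd (hs _ ht) (lt_irrefl _)
    · exact absurd (Sum.Lex.inr_lt_inr_iff.1 (hs _ ht)) Sum.Lex.not_inr_lt_inl
  · have hlt : ∀ j ∈ s₁.sort (· ≥ ·), k.1 > j := by
      intro j hj
      obtain ⟨hj, hjU⟩ := Finset.mem_filter.1 ((Finset.mem_sort _).1 hj)
      obtain ⟨t, ht, hj⟩ := Finset.mem_biUnion.1 hj
      rcases t with i | _ | i
      · exact absurd ((Finset.mem_singleton.1 hj) ▸ i.2.1) hjU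
      · exact absurd hj (Finset.notMem_empty _)
      · rw [Finset.mem_singleton.1 hj]
        exact (Sum.Lex.inr_lt_inr_iff.1 (Sum.Lex.inr_lt_inr_iff.1 (hs _ ht)) : i < k)
    refine key ((s₁.sort (· ≥ ·)).map a ++ c :: (s₂.sort (· ≥ ·)).map a) ?_
      (h (k.1 :: s₁.sort (· ≥ ·)) _ (List.pairwise_cons.2 ⟨hlt, s₁.sortedGT_sort.pairwise⟩)
        s₂.sortedGT_sort.pairwise (List.forall_mem_cons.2 ⟨k.2, hs₁⟩) hs₂).1
    intro t ht
    rcases t with i | _ | i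
    · exact List.mem_append_right _ (List.mem_cons_of_mem _
        (List.mem_map_of_mem ((Finset.mem_sort _).2 (mem₂ i ht))))
    · exact List.mem_append_right _ List.mem_cons_self
    · exact List.mem_append_left _ (List.mem_map_of_mem ((Finset.mem_sort _).2 (mem₁ i ht)))

end MorleySequences

/-! ### Inserting an element of the convex hull. -/

section Insertion

theorem mem_orderConvexHull_range {J X : Type*} [LinearOrder X] {a : J → X} {c : X}
    (hc : c ∈ orderConvexHull (Set.range a)) : (∃ i, a i ≤ c) ∧ ∃ j, c ≤ a j := by
  have := hc {x | (∃ i, a i ≤ x) ∧ ∃ j, x ≤ a j} ⟨⟨fun x hx y hy z hz =>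
    ⟨hx.1.imp fun _ h => h.trans hz.1, hy.2.imp fun _ h => hz.2.trans h⟩⟩, ?_⟩
  · exact this
  · rintro _ ⟨i, rfl⟩
    exact ⟨⟨i, le_rfl⟩, ⟨i, le_rfl⟩⟩

variable {L : FirstOrder.Language} {M : Type*} [L.Structure M] {A : Set M} {n : ℕ}
  {p : TypesOver L A n} [LinearOrder (locus p)] {J : Type*} [LinearOrder J]

theorem List.sublist_of_subset_of_pairwise_gt {l l' : List J} (h : l ⊆ l')
    (hl : l.Pairwise (· > ·)) (hl' : l'.Pairwise (· > ·)) : l.Sublist l' :=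
  List.sublist_of_subperm_of_pairwise (List.subperm_of_subset (hl.imp ne_of_gt) h) hl hl'

theorem List.exists_mem_forall_lt {P : J → Prop} (hne : ∃ j, P j)
    (h : ∀ j, P j → ∃ i, P i ∧ j < i) (l : List J) (hl : ∀ j ∈ l, P j) :
    ∃ i, P i ∧ ∀ j ∈ l, j < i := by
  induction l with
  | nil => exact hne.imp fun i hi => ⟨hi, by simp⟩
  | cons k l ih =>
    obtain ⟨hk, hl⟩ := List.forall_mem_cons.1 hl
    obtain ⟨i, hi, hil⟩ := ih hl
    rcases le_total k i with hki | hki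
    · obtain ⟨m, hm, him⟩ := h i hi
      exact ⟨m, hm, List.forall_mem_cons.2 ⟨hki.trans_lt him, fun j hj => (hil j hj).trans him⟩⟩
    · obtain ⟨m, hm, hkm⟩ := h k hk
      exact ⟨m, hm, List.forall_mem_cons.2 ⟨hkm, fun j hj => (hil j hj).trans_le (hki.trans hkm.le)⟩⟩

/-- Strictness may fail: over a one-point locus the sequence is constant. -/
theorem IsMorleySeq.monotone (hO : IsOrderedLocus L A (Subtype.val : locus p → Fin n → M))
    {a : J → locus p} (ha : IsMorleySeq L (rightGlobalization p) A (fun j => (a j).1)) :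
    Monotone a := by
  refine monotone_iff_forall_lt.2 fun i j hij => ?_
  exact hO.head_ge_of_morleyList (l₂ := []) (ha.morleyList (js := [j, i]) (by simpa using hij))

theorem isMorleySeq_removeInsert_of_mem_range {a : J → locus p}
    (ha : IsMorleySeq L (rightGlobalization p) A (fun j => (a j).1)) (j₀ : J) :
    IsMorleySeq L (rightGlobalization p) A
      (fun t => (removeInsert a {j₀} (LowerSet.Iio j₀) (a j₀) t).1) := by
  refine isMorleySeq_removeInsert ha fun l₁ l₂ h₁ h₂ hl₁ hl₂ => ?_
  rw [← List.map_cons, ← List.map_append]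
  refine ha.morleyList (List.pairwise_append.2 ⟨h₁, List.pairwise_cons.2 ⟨fun j hj => ?_, h₂⟩, ?_⟩)
  · exact (hl₂ j hj).1
  · have key : ∀ i ∈ l₁, j₀ < i := fun i hi =>
      lt_of_le_of_ne (not_lt.1 (hl₁ i hi).1) (Ne.symm (hl₁ i hi).2)
    intro i hi j hj
    rcases List.mem_cons.1 hj with rfl | hj
    · exact key i hi
    · exact ((hl₂ j hj).1 : j < j₀).trans (key i hi)

theorem exists_isMorleySeq_removeInsert
    (hO : IsOrderedLocus L A (Subtype.val : locus p → Fin n → M)) {a : J → locus p}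
    (ha : IsMorleySeq L (rightGlobalization p) A (fun j => (a j).1)) {c : locus p}
    (hlow : ∃ i, a i < c) (hup : ∃ j, c < a j) (hc : ∀ j, a j ≠ c) :
    ∃ R : Set J, R.Subsingleton ∧ ∃ U : LowerSet J,
      IsMorleySeq L (rightGlobalization p) A (fun t => (removeInsert a R U c t).1) := by
  classical
  have hmono := ha.monotone hO
  let U : LowerSet J := ⟨{j | a j < c}, fun i j hji hi => (hmono hji).trans_lt hi⟩
  have hU : ∀ j, j ∈ U ↔ a j < c := fun _ => Iff.rfl
  have hU' : ∀ {j}, j ∉ U → c < a j := fun {j} hj =>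
    lt_of_le_of_ne (not_lt.1 hj) (Ne.symm (hc j))
  have hlt : ∀ {i j}, i ∈ U → j ∉ U → i < j := fun hi hj =>
    not_le.1 fun hji => hj (U.lower hji hi)
  -- If, on each side of the cut, every finite set of retained indices has an index strictly nearer
  -- the cut, then `c` is squeezed between two old terms fitting its place.
  have of_bounds : ∀ R : Set J,
      (∀ l : List J, (∀ j ∈ l, j ∈ U ∧ j ∉ R) → ∃ i, i ∈ U ∧ ∀ j ∈ l, j < i) →
      (∀ l : List J, (∀ j ∈ l, j ∉ U ∧ j ∉ R) → ∃ i, i ∉ U ∧ ∀ j ∈ l, i < j) →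
      IsMorleySeq L (rightGlobalization p) A (fun t => (removeInsert a R U c t).1) := by
    intro R hR₁ hR₂
    refine isMorleySeq_removeInsert ha fun l₁ l₂ h₁ h₂ hl₁ hl₂ => ?_
    obtain ⟨m, hm, hml⟩ := hR₁ l₂ hl₂
    obtain ⟨k, hk, hkl⟩ := hR₂ l₁ hl₁
    have place : ∀ i, (∀ j ∈ l₂, j < i) → (∀ j ∈ l₁, i < j) →
        MorleyList L A (Subtype.val : locus p → _) (l₁.map a ++ a i :: l₂.map a) := by
      intro i hi hi'
      rw [← List.map_cons, ← List.map_append]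
      refine ha.morleyList (List.pairwise_append.2
        ⟨h₁, List.pairwise_cons.2 ⟨hi, h₂⟩, fun x hx y hy => ?_⟩)
      rcases List.mem_cons.1 hy with rfl | hy
      · exact hi' x hx
      · exact (hi y hy).trans (hi' x hx)
    exact hO.morleyList_of_between (place m hml fun j hj => hlt hm (hl₁ j hj).1)
      (place k (fun j hj => hlt (hl₂ j hj).1 hk) hkl) hm.le (hU' hk).le
  have low_max : ∀ m, m ∈ U → (∀ j ∈ U, j ≤ m) →
      ∀ l : List J, (∀ j ∈ l, j ∈ U ∧ j ∉ ({m} : Set J)) → ∃ i, i ∈ U ∧ ∀ j ∈ l, j < i :=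
    fun m hm hmax l hl => ⟨m, hm, fun j hj => lt_of_le_of_ne (hmax j (hl j hj).1) (hl j hj).2⟩
  have up_min : ∀ k, k ∉ U → (∀ j, j ∉ U → k ≤ j) →
      ∀ l : List J, (∀ j ∈ l, j ∉ U ∧ j ∉ ({k} : Set J)) → ∃ i, i ∉ U ∧ ∀ j ∈ l, i < j :=
    fun k hk hmin l hl =>
      ⟨k, hk, fun j hj => lt_of_le_of_ne (hmin j (hl j hj).1) (Ne.symm (hl j hj).2)⟩
  have low_no_max : (¬ ∃ m, m ∈ U ∧ ∀ j ∈ U, j ≤ m) → ∀ R : Set J,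
      ∀ l : List J, (∀ j ∈ l, j ∈ U ∧ j ∉ R) → ∃ i, i ∈ U ∧ ∀ j ∈ l, j < i := by
    intro H R l hl
    push Not at H
    exact List.exists_mem_forall_lt hlow H l fun j hj => (hl j hj).1
  have up_no_min : (¬ ∃ k, k ∉ U ∧ ∀ j, j ∉ U → k ≤ j) → ∀ R : Set J,
      ∀ l : List J, (∀ j ∈ l, j ∉ U ∧ j ∉ R) → ∃ i, i ∉ U ∧ ∀ j ∈ l, i < j := by
    intro H R l hl
    push Not at H
    exact List.exists_mem_forall_lt (J := Jᵒᵈ) (P := fun j => OrderDual.ofDual j ∉ U)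
      (hup.imp fun j hj => hj.not_gt) H l fun j hj => (hl j hj).1
  by_cases hmax : ∃ m, m ∈ U ∧ ∀ j ∈ U, j ≤ m
  swap
  · by_cases hmin : ∃ k, k ∉ U ∧ ∀ j, j ∉ U → k ≤ j
    · obtain ⟨k, hk, hmin⟩ := hmin
      exact ⟨{k}, Set.subsingleton_singleton, U,
        of_bounds _ (low_no_max hmax _) (up_min k hk hmin)⟩
    · exact ⟨∅, Set.subsingleton_empty, U, of_bounds _ (low_no_max hmax _) (up_no_min hmin _)⟩
  obtain ⟨m, hm, hmax⟩ := hmax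
  by_cases hmin : ∃ k, k ∉ U ∧ ∀ j, j ∉ U → k ≤ j
  swap
  · exact ⟨{m}, Set.subsingleton_singleton, U,
      of_bounds _ (low_max m hm hmax) (up_no_min hmin _)⟩
  obtain ⟨k, hk, hmin⟩ := hmin
  by_contra H
  -- Each removal, of `m` or of `k`, fails on some finite lists. The two failures are merged into
  -- `d₁` strictly above `k` and `d₂` strictly below `m`.
  have H₁ : ¬ _ := fun H' => H ⟨{m}, Set.subsingleton_singleton, U, isMorleySeq_removeInsert ha H'⟩
  have H₂ : ¬ _ := fun H' => H ⟨{k}, Set.subsingleton_singleton, U, isMorleySeq_removeInsert ha H'⟩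
  push Not at H₁ H₂
  obtain ⟨l₁, l₂, h₁, h₂, hl₁, hl₂, hl⟩ := H₁
  obtain ⟨l₁', l₂', h₁', h₂', hl₁', hl₂', hl'⟩ := H₂
  let s₁ := (l₁ ++ l₁').toFinset.erase k
  let s₂ := (l₂ ++ l₂').toFinset.erase m
  let d₁ := s₁.sort (· ≥ ·)
  let d₂ := s₂.sort (· ≥ ·)
  have mem₁ : ∀ {j}, j ∈ d₁ ↔ j ≠ k ∧ (j ∈ l₁ ∨ j ∈ l₁') := fun {j} => by simp [d₁, s₁]
  have mem₂ : ∀ {j}, j ∈ d₂ ↔ j ≠ m ∧ (j ∈ l₂ ∨ j ∈ l₂') := fun {j} => by simp [d₂, s₂]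
  have hd₁ : ∀ j ∈ d₁, k < j := fun j hj => by
    obtain ⟨hjk, hj⟩ := mem₁.1 hj
    exact lt_of_le_of_ne (hmin j (hj.elim (fun h => (hl₁ j h).1) fun h => (hl₁' j h).1)) hjk.symm
  have hd₂ : ∀ j ∈ d₂, j < m := fun j hj => by
    obtain ⟨hjm, hj⟩ := mem₂.1 hj
    exact lt_of_le_of_ne (hmax j (hj.elim (fun h => (hl₂ j h).1) fun h => (hl₂' j h).1)) hjm
  have hmk : m < k := hlt hm hk
  have pw₁ : (d₁ ++ [k]).Pairwise (· > ·) :=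
    List.pairwise_append.2 ⟨s₁.sortedGT_sort.pairwise, by simp, by simpa using hd₁⟩
  have pw₂ : (m :: d₂).Pairwise (· > ·) :=
    List.pairwise_cons.2 ⟨hd₂, s₂.sortedGT_sort.pairwise⟩
  have hle : ∀ j ∈ d₁ ++ [k], k ≤ j := by
    intro j hj
    rcases List.mem_append.1 hj with hj | hj
    · exact (hd₁ j hj).le
    · exact (List.mem_singleton.1 hj).ge
  have hle' : ∀ j ∈ m :: d₂, j ≤ m := by
    simpa using fun j hj => (hd₂ j hj).le
  have hMorley : MorleyList L A (Subtype.val : locus p → _)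
      ((d₁ ++ [k]).map a ++ (m :: d₂).map a) := by
    rw [← List.map_append]
    exact ha.morleyList (List.pairwise_append.2 ⟨pw₁, pw₂, fun i hi j hj =>
      (hle' j hj).trans_lt (hmk.trans_le (hle i hi))⟩)
  have : Nonempty (locus p) := ⟨c⟩
  obtain ⟨y, hy⟩ := hO.exists_morleyList_insert hMorley
  have sub₁ : l₁.Sublist (d₁ ++ [k]) := List.sublist_of_subset_of_pairwise_gt
    (fun j hj => by simp only [List.mem_append, List.mem_singleton, mem₁]; tauto) h₁ pw₁
  have sub₁' : l₁'.Sublist d₁ := List.sublist_of_subset_of_pairwise_gt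
    (fun j hj => mem₁.2 ⟨(hl₁' j hj).2, Or.inr hj⟩) h₁' s₁.sortedGT_sort.pairwise
  have sub₂ : l₂.Sublist d₂ := List.sublist_of_subset_of_pairwise_gt
    (fun j hj => mem₂.2 ⟨(hl₂ j hj).2, Or.inl hj⟩) h₂ s₂.sortedGT_sort.pairwise
  have sub₂' : l₂'.Sublist (m :: d₂) := List.sublist_of_subset_of_pairwise_gt
    (fun j hj => by simp only [List.mem_cons, mem₂]; tauto) h₂' pw₂
  -- With `y` inserted between `a m` and `a k`, either `a m ≤ c ≤ y` and `c` replaces `a m`, or `y ≤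
  -- c ≤ a k` and `c` replaces `a k`. Each case contradicts one of the failures.
  rcases le_total c y with hcy | hyc
  · refine hl ((hO.morleyList_of_between (l₁ := (d₁ ++ [k]).map a) (l₂ := d₂.map a) ?_ ?_ hm.le
      hcy).sublist ((sub₁.map a).append ((sub₂.map a).cons_cons c)))
    · exact hMorley
    · exact hy.sublist (List.Sublist.append_left (by simp) _)
  · refine hl' ((hO.morleyList_of_between (l₁ := d₁.map a) (l₂ := (m :: d₂).map a) ?_ ?_ hyc
      (hU' hk).le).sublist ((sub₁'.map a).append ((sub₂'.map a).cons_cons c)))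
    · exact hy.sublist (by simp)
    · simpa using hMorley

end Insertion

theorem mainTheorem12 {L : FirstOrder.Language} {M : Type*} [L.Structure M]
    {S : Type*} (sort : M → S) (hM : IsSaturatedModel L M sort)
    (A : Set M) (hA : Cardinal.mk A < Cardinal.mk M)
    {n : ℕ} (p : TypesOver L A n) [LinearOrder (locus p)] (hp : IsWeaklyOMinimalPair p)
    {J : Type*} [LinearOrder J] (a : J → locus p)
    (ha : IsMorleySeq L (rightGlobalization p) A (fun j => (a j).1)) :
    (∀ c : locus p, c ∈ orderConvexHull (Set.range a) →
      ∃ R : Set J, R.Subsingleton ∧ ∃ U : LowerSet J,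
        IsMorleySeq L (rightGlobalization p) A (fun t => (removeInsert a R U c t).1)) ∧
    (∀ a' : J → locus p,
      (∀ j : J, ¬ ForkIndep L A (a' j).1 (Set.range (a j).1)) →
      IsMorleySeq L (rightGlobalization p) A (fun j => (a' j).1)) := by
  have hO := hp.isOrderedLocus hM hA
  refine ⟨fun c hc => ?_, fun a' ha' => ?_⟩
  · by_cases hca : ∃ j, a j = c
    · obtain ⟨j, rfl⟩ := hca
      -- A term already in the sequence is removed and put back in its own place.
      exact ⟨{j}, Set.subsingleton_singleton, LowerSet.Iio j,
        isMorleySeq_removeInsert_of_mem_range ha j⟩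
    · push Not at hca
      obtain ⟨⟨i, hi⟩, ⟨j, hj⟩⟩ := mem_orderConvexHull_range hc
      exact exists_isMorleySeq_removeInsert hO ha ⟨i, hi.lt_of_ne (hca i)⟩
        ⟨j, hj.lt_of_ne (hca j).symm⟩ hca
  · exact isMorleySeq_of_morleyList fun js hjs =>
      hO.morleyList_of_forkDependent ha' js [] (ha.morleyList hjs)
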